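/- For real $p$ with $-\tfrac12<p<1$ put $$\alpha(p)=\frac{p^3(2+p)}{1+2p},\qquad \beta(p)=\frac{27p^2(1+p)^2}{4(1+p+p^2)^3},\qquad \alpha_\ell(p)=\frac{-p^3(2+p)}{(1-p^2)(1+p)^2},$$ $$\gamma(p)=\frac{1+p+p^2}{\sqrt{1+2p}},\qquad \gamma_\ell(p)=\frac{1+p+p^2}{(1+p)\sqrt{1-p^2}},$$ and let $$p^*=-\tfrac12\Big(1+\sqrt3-\sqrt{2\sqrt3}\Big),\qquad p^*_\ell=\tfrac12\Big(\sqrt{3+2\sqrt3}-1\Big).$$ Let ${}_2F_1(a,b;c;z)$ denote the sum of the Gauss hypergeometric series $$\sum_{n\ge0}\frac{(a)_n(b)_n}{(c)_n}\frac{z^n}{n!},$$ that is, the limit of its partial sums (the convergence may be conditional). Then $-\tfrac12<p^*<0<p^*_\ell<1$, and for every $p$ with $-\tfrac12<p<1$ $${}_2F_1\big(\tfrac13,\tfrac23;1;\beta(p)\big)=\begin{cases}\gamma_\ell(p)\;{}_2F_1\big(\tfrac12,\tfrac12;1;\alpha_\ell(p)\big) & \text{when } -\tfrac12<p\le p^*_\ell,\\[4pt]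 \gamma(p)\;{}_2F_1\big(\tfrac12,\tfrac12;1;\alpha(p)\big) & \text{when } p^*\le p<1,\end{cases}$$ where both formulas hold on the overlap of the two ranges. In each case, in the indicated range of $p$, the hypergeometric series involved converge; in particular, for $p^*\le p\le p^*_\ell$ the series for ${}_2F_1(\tfrac12,\tfrac12;1;\alpha(p))$ and ${}_2F_1(\tfrac12,\tfrac12;1;\alpha_\ell(p))$ both converge. -/

import Mathlib

open Filter Topology

noncomputable section

namespace RBBG

/-- The `n`-th term `(a)_n (b)_n / (c)_n * z ^ n / n!` of the real Gauss hypergeometric series. -/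
def gaussTerm (a b c z : ℝ) (n : ℕ) : ℝ :=
  ordinaryHypergeometricCoefficient a b c n * z ^ n

/-- Convergence of the Gauss hypergeometric series in the ordinary sense: its partial sums
`∑ n < N` have a limit in `ℝ`. The convergence may be conditional, as it is at `z = -1`
when `c = a + b`. -/
def GaussConverges (a b c z : ℝ) : Prop :=
  Summable (gaussTerm a b c z) (SummationFilter.conditional ℕ)

/-- The sum `₂F₁(a, b; c; z)` of the real Gauss hypergeometric series, the limit of its partial
sums. (Mathlib's `ordinaryHypergeometric` is an unconditional sum, hence has the value `0` at
points of conditional convergence.) -/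
def gauss2F1 (a b c z : ℝ) : ℝ :=
  ∑'[SummationFilter.conditional ℕ] n, gaussTerm a b c z n

def alpha (p : ℝ) : ℝ := p ^ 3 * (2 + p) / (1 + 2 * p)

def beta (p : ℝ) : ℝ := 27 * p ^ 2 * (1 + p) ^ 2 / (4 * (1 + p + p ^ 2) ^ 3)

def gamma (p : ℝ) : ℝ := (1 + p + p ^ 2) / √(1 + 2 * p)

def alphaL (p : ℝ) : ℝ := -p ^ 3 * (2 + p) / ((1 - p ^ 2) * (1 + p) ^ 2)

def gammaL (p : ℝ) : ℝ := (1 + p + p ^ 2) / ((1 + p) * √(1 - p ^ 2))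

def pStar : ℝ := -(1 / 2) * (1 + √3 - √(2 * √3))

def pStarL : ℝ := 1 / 2 * (√(3 + 2 * √3) - 1)

theorem gaussTerm_eq (a b c z : ℝ) (n : ℕ) :
    gaussTerm a b c z n =
      (ascPochhammer ℝ n).eval a * (ascPochhammer ℝ n).eval b / (ascPochhammer ℝ n).eval c
        * (z ^ n / (n.factorial : ℝ)) := by
  simp only [gaussTerm, ordinaryHypergeometricCoefficient]
  ring

theorem gaussConverges_iff (a b c z : ℝ) :
    GaussConverges a b c z ↔
      ∃ s, Tendsto (fun N => ∑ n ∈ Finset.range N, gaussTerm a b c z n) atTop (𝓝 s) := by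
  simp only [GaussConverges, Summable, HasSum, SummationFilter.conditional_filter_eq_map_range,
    tendsto_map'_iff, Function.comp_def]

theorem gauss2F1_eq_of_tendsto {a b c z s : ℝ}
    (h : Tendsto (fun N => ∑ n ∈ Finset.range N, gaussTerm a b c z n) atTop (𝓝 s)) :
    gauss2F1 a b c z = s := by
  have hs : HasSum (gaussTerm a b c z) s (SummationFilter.conditional ℕ) := by
    simpa only [HasSum, SummationFilter.conditional_filter_eq_map_range,
      tendsto_map'_iff, Function.comp_def] using h
  exact hs.tsum_eq

end RBBG

end

/-! When `a + b = c = 1` the hypergeometric equation is self-adjoint: `(z (1 - z) F')' = a b F`.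
Pulling back the equation of `₂F₁(1/3, 2/3; 1; ·)` along `beta` gives a Sturm-Liouville equation `(A
u')' = q u` in `p`. Dividing `₂F₁(1/2, 1/2; 1; z(p))` by a suitable `k` gives a solution of the same
equation, both for `z = alpha`, `k = 1 / gamma` and for `z = alphaL`, `k = 1 / gammaL`;
`gauss2F1_beta_eq` isolates the algebraic identities on `z` and `k` that this requires.

On the intervals used, `A` vanishes only at `0`, so the Wronskian argument of `eq_of_sturmLiouville`
shows that a solution regular at `0` is determined by its value there. Both sides are `1` at `p =
0`.

This covers the open ranges, bounded by the points where `alpha` or `alphaL` reaches `-1`. At those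
points the series converges by the alternating series test, and Abel's limit theorem carries the
identity over. -/

namespace RBBG

/-! ### Power series and hypergeometric coefficients. -/

/-- A power series with coefficients bounded by `1` may be differentiated termwise on the open
unit interval. -/
theorem hasDerivAt_tsum_mul_pow {c : ℕ → ℝ} (hc : ∀ n, |c n| ≤ 1) {z : ℝ} (hz : |z| < 1) :
    Summable (fun n => (n + 1) * c (n + 1) * z ^ n) ∧
      HasDerivAt (fun z => ∑' n, c n * z ^ n) (∑' n : ℕ, (n + 1) * c (n + 1) * z ^ n) z := by
  obtain ⟨r, hzr, hr⟩ := exists_between hz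
  have hr0 : 0 < r := (abs_nonneg z).trans_lt hzr
  have hu : Summable (fun n : ℕ => (n : ℝ) * r ^ (n - 1)) := by
    have h := (hasSum_coe_mul_geometric_of_norm_lt_one (r := r)
      (by rwa [Real.norm_of_nonneg hr0.le])).summable.mul_left r⁻¹
    refine h.congr fun n => ?_
    rcases n with _ | n
    · simp
    · rw [Nat.add_sub_cancel, pow_succ]
      field_simp
  have hbound : ∀ (n : ℕ) (y : ℝ), y ∈ Metric.ball (0 : ℝ) r →
      ‖c n * (n * y ^ (n - 1))‖ ≤ n * r ^ (n - 1) := by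
    intro n y hy
    rw [mem_ball_zero_iff, Real.norm_eq_abs] at hy
    rw [Real.norm_eq_abs, abs_mul, abs_mul, abs_pow, Nat.abs_cast]
    calc |c n| * (n * |y| ^ (n - 1)) ≤ 1 * (n * r ^ (n - 1)) := by
          gcongr
          exact hc n
      _ = _ := one_mul _
  have hz' : z ∈ Metric.ball (0 : ℝ) r := by simpa using hzr
  have hs0 : Summable fun n : ℕ => c n * (0 : ℝ) ^ n :=
    summable_of_ne_finset_zero (s := {0}) fun n hn => by
      rw [zero_pow (by simpa using hn), mul_zero]
  have hsum : Summable fun n : ℕ => c n * (n * z ^ (n - 1)) :=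
    Summable.of_norm_bounded hu fun n => hbound n z hz'
  have hd := hasDerivAt_tsum_of_isPreconnected (g := fun n z => c n * z ^ n)
    (g' := fun n z => c n * (n * z ^ (n - 1))) hu Metric.isOpen_ball
    (convex_ball (0 : ℝ) r).isPreconnected
    (fun n y _ => (hasDerivAt_pow n y).const_mul (c n)) hbound (Metric.mem_ball_self hr0) hs0 hz'
  have hshift : ∀ n : ℕ, c (n + 1) * (((n + 1 : ℕ) : ℝ) * z ^ (n + 1 - 1))
      = (n + 1) * c (n + 1) * z ^ n := fun n => by
    rw [Nat.add_sub_cancel]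
    push_cast
    ring
  refine ⟨((summable_nat_add_iff 1).2 hsum).congr hshift, ?_⟩
  rw [hsum.tsum_eq_zero_add] at hd
  simpa only [hshift, Nat.cast_zero, zero_mul, mul_zero, zero_add] using hd

section Coefficients

variable {a b : ℝ}

theorem ordinaryHypergeometricCoefficient_zero :
    ordinaryHypergeometricCoefficient a b 1 0 = 1 := by
  simp [ordinaryHypergeometricCoefficient]

theorem ordinaryHypergeometricCoefficient_succ (n : ℕ) :
    ordinaryHypergeometricCoefficient a b 1 (n + 1) =
      ordinaryHypergeometricCoefficient a b 1 n * ((a + n) * (b + n) / (n + 1) ^ 2) := by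
  simp only [ordinaryHypergeometricCoefficient, ascPochhammer_eval_one, ascPochhammer_succ_eval,
    Nat.factorial_succ]
  have hn : (n.factorial : ℝ) ≠ 0 := by positivity
  push_cast
  field_simp
  ring

theorem ordinaryHypergeometricCoefficient_pos (ha : 0 < a) (hb : 0 < b) (n : ℕ) :
    0 < ordinaryHypergeometricCoefficient a b 1 n := by
  induction n with
  | zero => rw [ordinaryHypergeometricCoefficient_zero]; exact one_pos
  | succ n ih =>
    rw [ordinaryHypergeometricCoefficient_succ]
    positivity

/-- For `a + b = 1` the ratio of consecutive coefficients is `(n² + n + a b) / (n + 1)²`, and `a b ≤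
1`. -/
theorem antitone_ordinaryHypergeometricCoefficient (ha : 0 < a) (hb : 0 < b) (hab : a + b = 1) :
    Antitone (ordinaryHypergeometricCoefficient a b 1) := by
  refine antitone_nat_of_succ_le fun n => ?_
  rw [ordinaryHypergeometricCoefficient_succ]
  refine mul_le_of_le_one_right (ordinaryHypergeometricCoefficient_pos ha hb n).le ?_
  rw [div_le_one (by positivity)]
  have hn : (0 : ℝ) ≤ n := n.cast_nonneg
  obtain rfl : b = 1 - a := by linarith
  nlinarith [sq_nonneg a]

theorem abs_ordinaryHypergeometricCoefficient_le_one (ha : 0 < a) (hb : 0 < b) (hab : a + b = 1)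
    (n : ℕ) : |ordinaryHypergeometricCoefficient a b 1 n| ≤ 1 := by
  rw [abs_of_pos (ordinaryHypergeometricCoefficient_pos ha hb n)]
  simpa only [ordinaryHypergeometricCoefficient_zero] using
    antitone_ordinaryHypergeometricCoefficient ha hb hab (Nat.zero_le n)

theorem tendsto_ordinaryHypergeometricCoefficient_half :
    Tendsto (ordinaryHypergeometricCoefficient (1 / 2 : ℝ) (1 / 2) 1) atTop (𝓝 0) := by
  have hle : ∀ n : ℕ, ordinaryHypergeometricCoefficient (1 / 2 : ℝ) (1 / 2) 1 n ≤
      1 / ((n : ℝ) + 1) := by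
    intro n
    induction n with
    | zero => rw [ordinaryHypergeometricCoefficient_zero]; norm_num
    | succ n ih =>
      rw [ordinaryHypergeometricCoefficient_succ]
      refine (mul_le_mul_of_nonneg_right ih (by positivity)).trans ?_
      push_cast
      -- The induction closes because `(n + 1/2)² (n + 2) ≤ (n + 1)³`.
      rw [div_mul_div_comm, div_le_div_iff₀ (by positivity) (by positivity)]
      have hn : (0 : ℝ) ≤ n := n.cast_nonneg
      nlinarith [mul_nonneg hn hn, mul_nonneg hn (mul_nonneg hn hn)]
  exact squeeze_zero (fun n => (ordinaryHypergeometricCoefficient_pos (by norm_num)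
    (by norm_num) n).le) hle tendsto_one_div_add_atTop_nhds_zero_nat

end Coefficients

/-! ### The Gauss series, its differential equation, and its behaviour at `-1`. -/

section Series

variable {a b z : ℝ}

theorem summable_gaussTerm (ha : 0 < a) (hb : 0 < b) (hab : a + b = 1) (hz : |z| < 1) :
    Summable (gaussTerm a b 1 z) := by
  refine Summable.of_norm_bounded (summable_geometric_of_lt_one (abs_nonneg z) hz) fun n => ?_
  rw [gaussTerm, Real.norm_eq_abs, abs_mul, abs_pow]
  exact mul_le_of_le_one_left (by positivity)
    (abs_ordinaryHypergeometricCoefficient_le_one ha hb hab n)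

theorem gaussConverges_of_abs_lt (ha : 0 < a) (hb : 0 < b) (hab : a + b = 1) (hz : |z| < 1) :
    GaussConverges a b 1 z :=
  (gaussConverges_iff _ _ _ _).2 ⟨_, (summable_gaussTerm ha hb hab hz).hasSum.tendsto_sum_nat⟩

theorem gauss2F1_eq_tsum (ha : 0 < a) (hb : 0 < b) (hab : a + b = 1) (hz : |z| < 1) :
    gauss2F1 a b 1 z = ∑' n, ordinaryHypergeometricCoefficient a b 1 n * z ^ n :=
  gauss2F1_eq_of_tendsto (summable_gaussTerm ha hb hab hz).hasSum.tendsto_sum_nat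

theorem gauss2F1_zero (ha : 0 < a) (hb : 0 < b) (hab : a + b = 1) : gauss2F1 a b 1 0 = 1 := by
  rw [gauss2F1_eq_tsum ha hb hab (by simp), tsum_eq_single 0 fun n hn => by simp [hn]]
  simp [ordinaryHypergeometricCoefficient_zero]

theorem one_le_gauss2F1 (ha : 0 < a) (hb : 0 < b) (hab : a + b = 1) (hz0 : 0 ≤ z) (hz : z < 1) :
    1 ≤ gauss2F1 a b 1 z := by
  have hz' : |z| < 1 := by rwa [abs_of_nonneg hz0]
  rw [gauss2F1_eq_tsum ha hb hab hz']
  have h := (summable_gaussTerm ha hb hab hz').le_tsum 0 fun n _ =>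
    mul_nonneg (ordinaryHypergeometricCoefficient_pos ha hb n).le (pow_nonneg hz0 n)
  simpa only [gaussTerm, ordinaryHypergeometricCoefficient_zero, pow_zero, mul_one] using h

/-- The hypergeometric differential equation with `a + b = c = 1` in self-adjoint form
`(z (1 - z) F')' = a b F`; here `H = z (1 - z) F'`. -/
theorem exists_gauss2F1_flux (ha : 0 < a) (hb : 0 < b) (hab : a + b = 1) :
    ∃ D H : ℝ → ℝ, H 0 = 0 ∧ ∀ z, |z| < 1 → HasDerivAt (gauss2F1 a b 1) (D z) z ∧
      z * (1 - z) * D z = H z ∧ HasDerivAt H (a * b * gauss2F1 a b 1 z) z := by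
  set c := ordinaryHypergeometricCoefficient a b 1 with hcdef
  have hc := abs_ordinaryHypergeometricCoefficient_le_one ha hb hab
  -- Coefficients of the termwise primitive of `a b F` that vanishes at `0`.
  let h : ℕ → ℝ := fun n => Nat.casesOn n 0 fun m => a * b * c m / (m + 1)
  have h0 : h 0 = 0 := rfl
  have hsucc : ∀ n, h (n + 1) = a * b * c n / (n + 1) := fun n => rfl
  have hh : ∀ n, |h n| ≤ 1 := by
    rintro (_ | n)
    · simp [h0]
    · rw [hsucc, abs_div, abs_mul, abs_of_pos (mul_pos ha hb),
        abs_of_pos (by positivity : (0 : ℝ) < n + 1)]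
      refine div_le_one_of_le₀ ?_ (by positivity)
      have hab1 : a * b ≤ 1 := by nlinarith
      calc a * b * |c n| ≤ 1 * 1 := by
            gcongr
            exact hc n
        _ ≤ n + 1 := by simp
  -- This is `z (1 - z) F' = H` coefficientwise; it comes down to `(a + n) (b + n) - n (n + 1) = a
  -- b`, which needs `a + b = 1`.
  have hrec : ∀ n : ℕ, h (n + 1) = (n + 1) * c (n + 1) - n * c n := fun n => by
    rw [hsucc, hcdef, ordinaryHypergeometricCoefficient_succ]
    obtain rfl : b = 1 - a := by linarith
    field_simp
    ring
  refine ⟨fun z => ∑' n : ℕ, (n + 1) * c (n + 1) * z ^ n, fun z => ∑' n, h n * z ^ n, ?_,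
    fun z hz => ⟨?_, ?_, ?_⟩⟩
  · exact (tsum_congr fun n => by rcases n with _ | n <;> simp [h0]).trans tsum_zero
  · refine (hasDerivAt_tsum_mul_pow hc hz).2.congr_of_eventuallyEq ?_
    filter_upwards [(isOpen_lt continuous_abs continuous_const).mem_nhds hz] with y hy
    exact gauss2F1_eq_tsum ha hb hab hy
  · have hS := (hasDerivAt_tsum_mul_pow hc hz).1.hasSum
    set S := ∑' n : ℕ, (n + 1) * c (n + 1) * z ^ n
    have h1 : HasSum (fun n : ℕ => (n + 1) * c (n + 1) * z ^ (n + 1)) (S * z) :=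
      (hS.mul_right z).congr_fun fun n => by ring
    have h2 : HasSum (fun n : ℕ => n * c n * z ^ n) (S * z) := by
      refine (hasSum_nat_add_iff' 1).1 ?_
      simpa using h1
    have h3 : HasSum (fun n : ℕ => h (n + 1) * z ^ (n + 1)) (S * z - S * z * z) :=
      (h1.sub (h2.mul_right z)).congr_fun fun n => by
        rw [hrec]
        ring
    have h4 : HasSum (fun n : ℕ => h n * z ^ n) (S * z - S * z * z) := by
      refine (hasSum_nat_add_iff' 1).1 ?_
      simpa [h0] using h3
    refine Eq.trans ?_ h4.tsum_eq.symm
    change z * (1 - z) * S = _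
    ring
  · refine (hasDerivAt_tsum_mul_pow hh hz).2.congr_deriv ?_
    rw [gauss2F1_eq_tsum ha hb hab hz, ← hcdef, ← tsum_mul_left]
    refine tsum_congr fun n => ?_
    rw [hsucc]
    field_simp

theorem exists_tendsto_gaussTerm_half_neg_one :
    ∃ s, Tendsto (fun N => ∑ n ∈ Finset.range N, gaussTerm (1 / 2) (1 / 2) 1 (-1) n)
      atTop (𝓝 s) := by
  obtain ⟨s, hs⟩ := (antitone_ordinaryHypergeometricCoefficient (a := 1 / 2) (b := 1 / 2)
    (by norm_num) (by norm_num) (by norm_num)).tendsto_alternating_series_of_tendsto_zero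
    tendsto_ordinaryHypergeometricCoefficient_half
  exact ⟨s, by simpa only [gaussTerm, mul_comm] using hs⟩

theorem gaussConverges_half (hz : -1 ≤ z) (hz1 : z < 1) :
    GaussConverges (1 / 2) (1 / 2) 1 z := by
  rcases hz.eq_or_lt with rfl | hz
  · exact (gaussConverges_iff _ _ _ _).2 exists_tendsto_gaussTerm_half_neg_one
  · exact gaussConverges_of_abs_lt (by norm_num) (by norm_num) (by norm_num) (abs_lt.2 ⟨hz, hz1⟩)

/-- Abel's limit theorem for the series with alternating coefficients, transported from `1` to `-1`
by `z ↦ -z`. -/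
theorem tendsto_gauss2F1_half_neg_one :
    Tendsto (gauss2F1 (1 / 2) (1 / 2) 1) (𝓝[>] (-1)) (𝓝 (gauss2F1 (1 / 2) (1 / 2) 1 (-1))) := by
  obtain ⟨s, hs⟩ := exists_tendsto_gaussTerm_half_neg_one
  rw [gauss2F1_eq_of_tendsto hs]
  have habel := Real.tendsto_tsum_powerSeries_nhdsWithin_lt hs
  have hneg : Tendsto (fun z : ℝ => -z) (𝓝[>] (-1)) (𝓝[<] 1) := by
    refine tendsto_nhdsWithin_iff.2 ⟨?_, ?_⟩
    · refine Tendsto.mono_left ?_ nhdsWithin_le_nhds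
      simpa using (continuous_neg (G := ℝ)).tendsto (-1)
    · filter_upwards [self_mem_nhdsWithin] with z hz
      exact neg_lt.1 (Set.mem_Ioi.1 hz)
  refine (habel.comp hneg).congr' ?_
  filter_upwards [Ioo_mem_nhdsGT (show (-1 : ℝ) < 1 by norm_num)] with z hz
  rw [gauss2F1_eq_tsum (by norm_num) (by norm_num) (by norm_num) (abs_lt.2 hz)]
  refine tsum_congr fun n => ?_
  rw [gaussTerm, mul_assoc, ← mul_pow, neg_one_mul, neg_neg]

end Series

/-! ### Uniqueness for the singular equation and the pullback along `beta`. -/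

/-- Two solutions of the singular Sturm-Liouville equation `(A u')' = q u` on an interval around
the only zero `0` of `A` agree if they agree at `0`. Here `U = A u'` and `V = A v'`. -/
theorem eq_of_sturmLiouville {l r : ℝ} (hl : l < 0) (hr : 0 < r) {A q u u' U v v' V : ℝ → ℝ}
    (hA : ∀ x ∈ Set.Ioo l r, x ≠ 0 → A x ≠ 0)
    (hu : ∀ x ∈ Set.Ioo l r, HasDerivAt u (u' x) x)
    (hU : ∀ x ∈ Set.Ioo l r, HasDerivAt U (q x * u x) x)
    (hAu : ∀ x ∈ Set.Ioo l r, A x * u' x = U x)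
    (hv : ∀ x ∈ Set.Ioo l r, HasDerivAt v (v' x) x)
    (hV : ∀ x ∈ Set.Ioo l r, HasDerivAt V (q x * v x) x)
    (hAv : ∀ x ∈ Set.Ioo l r, A x * v' x = V x)
    (hU0 : U 0 = 0) (hV0 : V 0 = 0) (hu0 : ∀ x ∈ Set.Ioo l r, u x ≠ 0) (huv : u 0 = v 0) :
    ∀ x ∈ Set.Ioo l r, u x = v x := by
  have h0 : (0 : ℝ) ∈ Set.Ioo l r := ⟨hl, hr⟩
  -- The weighted Wronskian `A (u v' - v u')` is constant, and it is `0` at the singular point since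
  -- `U` and `V` vanish there.
  have hW : ∀ x ∈ Set.Ioo l r, HasDerivAt (fun y => u y * V y - v y * U y) 0 x := fun x hx => by
    refine (((hu x hx).fun_mul (hV x hx)).fun_sub ((hv x hx).fun_mul (hU x hx))).congr_deriv ?_
    linear_combination v' x * hAu x hx - u' x * hAv x hx
  have hW0 : ∀ x ∈ Set.Ioo l r, u x * V x - v x * U x = 0 := fun x hx => by
    have h := isOpen_Ioo.is_const_of_deriv_eq_zero isPreconnected_Ioo
      (fun y hy => (hW y hy).differentiableAt.differentiableWithinAt)
      (fun y hy => (hW y hy).deriv) hx h0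
    simpa only [hU0, hV0, mul_zero, sub_zero] using h
  have hD : ∀ x ∈ Set.Ioo l r, x ≠ 0 → HasDerivAt (fun y => v y / u y) 0 x := fun x hx hx0 => by
    refine ((hv x hx).fun_div (hu x hx) (hu0 x hx)).congr_deriv ?_
    have : A x * (v' x * u x - v x * u' x) = 0 := by
      linear_combination hW0 x hx + u x * hAv x hx - v x * hAu x hx
    rw [(mul_eq_zero.1 this).resolve_left (hA x hx hx0), zero_div]
  have hcont : ContinuousOn (fun y => v y / u y) (Set.Ioo l r) := fun x hx =>
    ((hv x hx).continuousAt.div (hu x hx).continuousAt (hu0 x hx)).continuousWithinAt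
  have hconst : ∀ x ∈ Set.Ioo l r, v x / u x = v 0 / u 0 := by
    intro x hx
    -- The derivative of `v / u` is not known to vanish at `0`; the mean value theorem between `x`
    -- and `0` only needs it in the interior.
    rcases lt_trichotomy x 0 with hx0 | rfl | hx0
    · obtain ⟨y, -, hy⟩ := exists_hasDerivAt_eq_slope (fun y => v y / u y) (fun _ => 0) hx0
        (hcont.mono (Set.Icc_subset_Ioo hx.1 hr))
        fun y hy => hD y ⟨hx.1.trans hy.1, hy.2.trans hr⟩ hy.2.ne
      rw [eq_comm, div_eq_zero_iff] at hy
      rcases hy with hy | hy <;> linarith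
    · rfl
    · obtain ⟨y, -, hy⟩ := exists_hasDerivAt_eq_slope (fun y => v y / u y) (fun _ => 0) hx0
        (hcont.mono (Set.Icc_subset_Ioo hl hx.2))
        fun y hy => hD y ⟨hl.trans hy.1, hy.2.trans hx.2⟩ hy.1.ne'
      rw [eq_comm, div_eq_zero_iff] at hy
      rcases hy with hy | hy <;> linarith
  intro x hx
  have h := hconst x hx
  rw [← huv, div_self (hu0 0 h0), div_eq_one_iff_eq (hu0 x hx)] at h
  exact h.symm

theorem one_add_self_add_sq_pos (p : ℝ) : 0 < 1 + p + p ^ 2 := by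
  nlinarith [sq_nonneg (2 * p + 1)]

theorem beta_nonneg (p : ℝ) : 0 ≤ beta p := by
  have := one_add_self_add_sq_pos p
  unfold beta
  positivity

theorem one_sub_beta (p : ℝ) :
    1 - beta p = (1 - p) ^ 2 * (1 + 2 * p) ^ 2 * (2 + p) ^ 2 / (4 * (1 + p + p ^ 2) ^ 3) := by
  have := (one_add_self_add_sq_pos p).ne'
  unfold beta
  field_simp
  ring

theorem beta_lt_one {p : ℝ} (hp : -(1 / 2) < p) (hp1 : p < 1) : beta p < 1 := by
  have h1 := one_add_self_add_sq_pos p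
  have h2 : 0 < 1 - p := by linarith
  have h3 : 0 < 1 + 2 * p := by linarith
  have h4 : 0 < 2 + p := by linarith
  rw [← sub_pos, one_sub_beta]
  positivity

theorem abs_beta_lt_one {p : ℝ} (hp : -(1 / 2) < p) (hp1 : p < 1) : |beta p| < 1 := by
  rw [abs_of_nonneg (beta_nonneg p)]
  exact beta_lt_one hp hp1

theorem hasDerivAt_beta (p : ℝ) : HasDerivAt beta
    (27 * p * (1 + p) * (1 + 2 * p) * (1 - p) * (2 + p) / (4 * (1 + p + p ^ 2) ^ 4)) p := by
  have h0 := (one_add_self_add_sq_pos p).ne'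
  have hid := hasDerivAt_id' p
  refine ((((hid.fun_pow 2).const_mul 27).fun_mul ((hid.const_add 1).fun_pow 2)).fun_div
    ((((hid.const_add 1).fun_add (hid.fun_pow 2)).fun_pow 3).const_mul 4)
    (by positivity)).congr_deriv ?_
  field_simp
  ring

/-- A function `k⁻¹ F(z)`, with `F` the hypergeometric function of parameters `1/2, 1/2; 1`, equals
`G(β)`, with `G` that of parameters `1/3, 2/3; 1`, if it satisfies the same Sturm-Liouville
equation. The logarithmic derivative of `k` is `L`, and `B = z (1 - z) / z'`. -/
theorem gauss2F1_beta_eq {l r : ℝ} (hl : -(1 / 2) ≤ l) (hl0 : l < 0) (hr0 : 0 < r) (hr : r ≤ 1)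
    {z z' k L B : ℝ → ℝ} (hz : ∀ x ∈ Set.Ioo l r, |z x| < 1)
    (hz' : ∀ x ∈ Set.Ioo l r, HasDerivAt z (z' x) x)
    (hB : ∀ x ∈ Set.Ioo l r, B x * z' x = z x * (1 - z x))
    (hk : ∀ x ∈ Set.Ioo l r, k x ≠ 0)
    (hk' : ∀ x ∈ Set.Ioo l r, HasDerivAt k (k x * L x) x)
    (hBk : ∀ x ∈ Set.Ioo l r, 6 * (B x * k x ^ 2) =
      x * (1 - x) * (1 + x) * (2 + x) * (1 + 2 * x) / (1 + x + x ^ 2) ^ 2)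
    (hBL : ∀ x ∈ Set.Ioo l r, HasDerivAt (fun y => B y * L y)
      (z' x / 4 - B x * L x ^ 2 - 6 * B x / (1 + x + x ^ 2) ^ 2) x)
    (hz0 : z 0 = 0) (hk0 : k 0 = 1) (hL0 : L 0 = 0) :
    ∀ x ∈ Set.Ioo l r,
      gauss2F1 (1 / 3) (2 / 3) 1 (beta x) = (k x)⁻¹ * gauss2F1 (1 / 2) (1 / 2) 1 (z x) := by
  obtain ⟨D, H, hH0, hF⟩ := exists_gauss2F1_flux (a := 1 / 2) (b := 1 / 2)
    (by norm_num) (by norm_num) (by norm_num)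
  obtain ⟨E, J, hJ0, hG⟩ := exists_gauss2F1_flux (a := 1 / 3) (b := 2 / 3)
    (by norm_num) (by norm_num) (by norm_num)
  set F := gauss2F1 (1 / 2) (1 / 2) 1
  set G := gauss2F1 (1 / 3) (2 / 3) 1
  have hmem : ∀ x ∈ Set.Ioo l r, -(1 / 2) < x ∧ x < 1 := fun x hx =>
    ⟨hl.trans_lt hx.1, hx.2.trans_le hr⟩
  have hβ : ∀ x ∈ Set.Ioo l r, |beta x| < 1 := fun x hx =>
    abs_beta_lt_one (hmem x hx).1 (hmem x hx).2
  have hβ0 : beta 0 = 0 := by simp [beta]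
  refine eq_of_sturmLiouville hl0 hr0
    -- Here `A = β (1 - β) / β'` with the removable singularity at `0` cancelled, and `q = (2/9)
    -- β'`, where `2/9 = 1/3 * 2/3`.
    (A := fun x => x * (1 - x) * (1 + x) * (2 + x) * (1 + 2 * x) / (4 * (1 + x + x ^ 2) ^ 2))
    (q := fun x => 3 * x * (1 + x) * (1 + 2 * x) * (1 - x) * (2 + x) / (2 * (1 + x + x ^ 2) ^ 4))
    (u := fun x => G (beta x))
    (u' := fun x => E (beta x) *
      (27 * x * (1 + x) * (1 + 2 * x) * (1 - x) * (2 + x) / (4 * (1 + x + x ^ 2) ^ 4)))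
    (U := fun x => J (beta x))
    (v := fun x => (k x)⁻¹ * F (z x))
    (v' := fun x => (k x)⁻¹ * (D (z x) * z' x - L x * F (z x)))
    -- By `hBk`, `A = (3/2) B k²` and `q = 9 B k² / (1 + x + x²)²`. In `V'` the terms with `D`
    -- cancel, and `hBL` says that the remaining coefficient of `F` gives `q v`.
    (V := fun x => 3 / 2 * (k x * (H (z x) - B x * L x * F (z x))))
    ?_ ?_ ?_ ?_ ?_ ?_ ?_ ?_ ?_ ?_ ?_
  · intro x hx hx0
    have h0 := one_add_self_add_sq_pos x
    obtain ⟨h1, h2⟩ := hmem x hx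
    have h3 : 1 - x ≠ 0 := by linarith
    have h4 : 1 + x ≠ 0 := by linarith
    have h5 : 2 + x ≠ 0 := by linarith
    have h6 : 1 + 2 * x ≠ 0 := by linarith
    positivity
  · exact fun x hx => (hG _ (hβ x hx)).1.comp x (hasDerivAt_beta x)
  · intro x hx
    have h0 := (one_add_self_add_sq_pos x).ne'
    refine ((hG _ (hβ x hx)).2.2.comp x (hasDerivAt_beta x)).congr_deriv ?_
    field_simp
    ring
  · intro x hx
    have h0 := (one_add_self_add_sq_pos x).ne'
    rw [← (hG _ (hβ x hx)).2.1, one_sub_beta]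
    unfold beta
    field_simp
  · intro x hx
    have hk := hk x hx
    refine (((hk' x hx).fun_inv hk).fun_mul
      ((hF _ (hz x hx)).1.comp x (hz' x hx))).congr_deriv ?_
    simp only [Function.comp_apply]
    field_simp
    ring
  · intro x hx
    have hk := hk x hx
    have h0 := (one_add_self_add_sq_pos x).ne'
    refine (((hk' x hx).fun_mul (((hF _ (hz x hx)).2.2.comp x (hz' x hx)).fun_sub
      ((hBL x hx).fun_mul ((hF _ (hz x hx)).1.comp x (hz' x hx))))).const_mul (3 / 2)).congr_deriv ?_
    simp only [Function.comp_apply]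
    have hBk := hBk x hx
    have hH : H (z x) = B x * z' x * D (z x) := by rw [← (hF _ (hz x hx)).2.1, hB x hx]
    rw [hH]
    have hq : 3 * x * (1 + x) * (1 + 2 * x) * (1 - x) * (2 + x) / (2 * (1 + x + x ^ 2) ^ 4) =
        9 * (B x * k x ^ 2) / (1 + x + x ^ 2) ^ 2 := by
      rw [show 9 * (B x * k x ^ 2) = 3 / 2 * (6 * (B x * k x ^ 2)) by ring, hBk]
      field_simp
    rw [hq]
    field_simp
    ring
  · intro x hx
    have hk := hk x hx
    have h0 := (one_add_self_add_sq_pos x).ne'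
    have hH : H (z x) = B x * z' x * D (z x) := by rw [← (hF _ (hz x hx)).2.1, hB x hx]
    have hA : x * (1 - x) * (1 + x) * (2 + x) * (1 + 2 * x) / (4 * (1 + x + x ^ 2) ^ 2) =
        3 / 2 * (B x * k x ^ 2) := by
      rw [show 3 / 2 * (B x * k x ^ 2) = 1 / 4 * (6 * (B x * k x ^ 2)) by ring, hBk x hx]
      field_simp
    simp only [hA, hH]
    field_simp
  · simp only [hβ0, hJ0]
  · simp only [hz0, hH0, hL0, mul_zero, zero_mul, sub_zero]
  · intro x hx
    exact (zero_lt_one.trans_le (one_le_gauss2F1 (by norm_num) (by norm_num) (by norm_num)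
      (beta_nonneg x) (beta_lt_one (hmem x hx).1 (hmem x hx).2))).ne'
  · simp only [hβ0, hz0, hk0, F, G, inv_one, one_mul]
    rw [gauss2F1_zero (by norm_num) (by norm_num) (by norm_num),
      gauss2F1_zero (by norm_num) (by norm_num) (by norm_num)]

/-! ### The endpoints and the ranges of `alpha` and `alphaL`. -/

theorem neg_half_lt_pStar : -(1 / 2) < pStar := by
  have h : √3 < √(2 * √3) := Real.lt_sqrt_of_sq_lt (by
    nlinarith [Real.sq_sqrt (show (0 : ℝ) ≤ 3 by norm_num), Real.sqrt_nonneg 3])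
  unfold pStar
  linarith

theorem pStar_neg : pStar < 0 := by
  have h : √(2 * √3) < 1 + √3 := by
    rw [Real.sqrt_lt' (by positivity)]
    nlinarith [Real.sqrt_nonneg 3]
  unfold pStar
  linarith

theorem pStarL_pos : 0 < pStarL := by
  have h : 1 < √(3 + 2 * √3) := Real.lt_sqrt_of_sq_lt (by nlinarith [Real.sqrt_nonneg 3])
  unfold pStarL
  linarith

theorem pStarL_lt_one : pStarL < 1 := by
  have h3 : √3 < 3 := by
    rw [Real.sqrt_lt' (by norm_num)]
    norm_num
  have h : √(3 + 2 * √3) < 3 := by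
    rw [Real.sqrt_lt' (by norm_num)]
    linarith
  unfold pStarL
  linarith

theorem one_sub_alpha {p : ℝ} (hp : 0 < 1 + 2 * p) :
    1 - alpha p = (1 - p) * (1 + p) ^ 3 / (1 + 2 * p) := by
  have hp' : 1 + p * 2 ≠ 0 := by linarith
  unfold alpha
  field_simp
  ring

theorem alpha_lt_one {p : ℝ} (hp : -(1 / 2) < p) (hp1 : p < 1) : alpha p < 1 := by
  have h1 : 0 < 1 - p := by linarith
  have h2 : 0 < 1 + p := by linarith
  have h3 : 0 < 1 + 2 * p := by linarith
  rw [← sub_pos, one_sub_alpha h3]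
  positivity

/-- The numerator `p⁴ + 2p³ + 2p + 1` is palindromic: in `y = p + 1/p` it becomes `y² + 2y - 2`,
with roots `-1 ± √3`. `pStar` is a root of the factor with `y = -1 - √3`. -/
theorem one_add_alpha {p : ℝ} (hp : 0 < 1 + 2 * p) :
    1 + alpha p = (p - pStar) * (p + pStar + 1 + √3) * (p ^ 2 + (1 - √3) * p + 1) / (1 + 2 * p) := by
  have h3 : √3 ^ 2 = 3 := Real.sq_sqrt (by norm_num)
  have hs : √(2 * √3) ^ 2 = 2 * √3 := Real.sq_sqrt (by positivity)
  have h : (p - pStar) * (p + pStar + 1 + √3) = p ^ 2 + (1 + √3) * p + 1 := by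
    unfold pStar
    linear_combination (1 / 4) * h3 - (1 / 4) * hs
  have hp' : 1 + p * 2 ≠ 0 := by linarith
  rw [h]
  unfold alpha
  field_simp
  linear_combination p ^ 2 * h3

theorem neg_one_lt_alpha {p : ℝ} (hp : pStar < p) : -1 < alpha p := by
  have h0 := neg_half_lt_pStar
  have h3 : √3 ^ 2 = 3 := Real.sq_sqrt (by norm_num)
  have hlt : √3 < 2 := by
    rw [Real.sqrt_lt' (by norm_num)]
    norm_num
  have hnn := Real.sqrt_nonneg 3
  have h1 : 0 < p - pStar := by linarith
  have h2 : 0 < p + pStar + 1 + √3 := by nlinarith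
  have h4 : 0 < p ^ 2 + (1 - √3) * p + 1 := by
    nlinarith [sq_nonneg (2 * p + (1 - √3))]
  have h5 : 0 < 1 + 2 * p := by linarith
  have : 0 < 1 + alpha p := by
    rw [one_add_alpha h5]
    positivity
  linarith

theorem alpha_pStar : alpha pStar = -1 := by
  have h0 := neg_half_lt_pStar
  have h := one_add_alpha (p := pStar) (by linarith)
  rw [sub_self, zero_mul, zero_mul, zero_div] at h
  linarith

theorem alphaL_lt_one {p : ℝ} (hp : -(1 / 2) < p) (hp1 : p < 1) : alphaL p < 1 := by
  have h1 : 0 < 1 - p := by linarith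
  have h2 : 0 < 1 + p := by linarith
  have h3 : 0 < 1 + 2 * p := by linarith
  have h4 : 1 - p ^ 2 = (1 - p) * (1 + p) := by ring
  have : 1 - alphaL p = (1 + 2 * p) / ((1 - p) * (1 + p) ^ 3) := by
    unfold alphaL
    rw [h4]
    field_simp
    ring
  rw [← sub_pos, this]
  positivity

/-- In `t = p² + p` the numerator is `1 + 2t - 2t²`, with roots `(1 ± √3) / 2`; `pStarL` solves `t =
(1 + √3) / 2`. -/
theorem one_add_alphaL {p : ℝ} (hp : -(1 / 2) < p) (hp1 : p < 1) :
    1 + alphaL p = (pStarL - p) * (pStarL + p + 1) * (2 * (p ^ 2 + p) + √3 - 1) /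
      ((1 - p) * (1 + p) ^ 3) := by
  have h1 : 1 - p ≠ 0 := by linarith
  have h2 : 1 + p ≠ 0 := by linarith
  have h4 : 1 - p ^ 2 = (1 - p) * (1 + p) := by ring
  have h3 : √3 ^ 2 = 3 := Real.sq_sqrt (by norm_num)
  have hs : √(3 + 2 * √3) ^ 2 = 3 + 2 * √3 := Real.sq_sqrt (by positivity)
  have h : (pStarL - p) * (pStarL + p + 1) = (1 + √3) / 2 - (p ^ 2 + p) := by
    unfold pStarL
    linear_combination (1 / 4) * hs
  rw [h]
  unfold alphaL
  rw [h4]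
  field_simp
  linear_combination -h3

theorem neg_one_lt_alphaL {p : ℝ} (hp : -(1 / 2) < p) (hpL : p < pStarL) : -1 < alphaL p := by
  have hL := pStarL_lt_one
  have hL0 := pStarL_pos
  have h1 : 0 < 1 - p := by linarith
  have h2 : 0 < 1 + p := by linarith
  have h3 : 0 < pStarL - p := by linarith
  have h4 : 0 < pStarL + p + 1 := by linarith
  -- The bound `3/2` suffices because `2 (p² + p) ≥ -1/2`.
  have hlt : 3 / 2 < √3 := Real.lt_sqrt_of_sq_lt (by norm_num)
  have h5 : 0 < 2 * (p ^ 2 + p) + √3 - 1 := by nlinarith [sq_nonneg (2 * p + 1)]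
  have : 0 < 1 + alphaL p := by
    rw [one_add_alphaL hp (hpL.trans hL)]
    positivity
  linarith

theorem alphaL_pStarL : alphaL pStarL = -1 := by
  have hL0 := pStarL_pos
  have h := one_add_alphaL (p := pStarL) (by linarith) pStarL_lt_one
  rw [sub_self, zero_mul, zero_mul, zero_div] at h
  linarith

/-! ### The two identities on the open ranges. -/

theorem hasDerivAt_alpha {p : ℝ} (hp : 0 < 1 + 2 * p) :
    HasDerivAt alpha (6 * p ^ 2 * (1 + p) ^ 2 / (1 + 2 * p) ^ 2) p := by
  have hid := hasDerivAt_id' p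
  refine (((hid.fun_pow 3).fun_mul (hid.const_add 2)).fun_div
    ((hid.const_mul 2).const_add 1) hp.ne').congr_deriv ?_
  field_simp
  ring

theorem hasDerivAt_alphaL {p : ℝ} (hp : 1 - p ≠ 0) (hp' : 1 + p ≠ 0) :
    HasDerivAt alphaL (-6 * p ^ 2 / ((1 - p) ^ 2 * (1 + p) ^ 4)) p := by
  have hid := hasDerivAt_id' p
  have h4 : 1 - p ^ 2 = (1 - p) * (1 + p) := by ring
  refine (((hid.fun_pow 3).fun_neg.fun_mul (hid.const_add 2)).fun_div
    (((hid.fun_pow 2).const_sub 1).fun_mul ((hid.const_add 1).fun_pow 2))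
    (by rw [h4]; positivity)).congr_deriv ?_
  rw [h4]
  field_simp
  ring

/-- Logarithmic differentiation, giving the form `k * L` in which `gauss2F1_beta_eq` takes the
derivative of `k`. -/
theorem hasDerivAt_sqrt_div {f g : ℝ → ℝ} {f' g' x : ℝ} (hf : HasDerivAt f f' x)
    (hg : HasDerivAt g g' x) (hf0 : 0 < f x) (hg0 : g x ≠ 0) :
    HasDerivAt (fun y => √(f y) / g y)
      (√(f x) / g x * (f' / (2 * f x) - g' / g x)) x := by
  refine ((hf.sqrt hf0.ne').fun_div hg hg0).congr_deriv ?_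
  have hs : 0 < √(f x) := Real.sqrt_pos.2 hf0
  have hsq : √(f x) ^ 2 = f x := Real.sq_sqrt hf0.le
  rw [← hsq, Real.sqrt_sq hs.le]
  field_simp

theorem hasDerivAt_one_add_self_add_sq (x : ℝ) :
    HasDerivAt (fun y : ℝ => 1 + y + y ^ 2) (1 + 2 * x) x := by
  have hid := hasDerivAt_id' x
  refine ((hid.const_add 1).fun_add (hid.fun_pow 2)).congr_deriv ?_
  ring

theorem gauss2F1_beta_eq_gamma_mul {p : ℝ} (hp : pStar < p) (hp1 : p < 1) :
    gauss2F1 (1 / 3) (2 / 3) 1 (beta p) = gamma p * gauss2F1 (1 / 2) (1 / 2) 1 (alpha p) := by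
  have hmem : ∀ x ∈ Set.Ioo pStar 1, -(1 / 2) < x ∧ x < 1 := fun x hx =>
    ⟨neg_half_lt_pStar.trans hx.1, hx.2⟩
  rw [gauss2F1_beta_eq neg_half_lt_pStar.le pStar_neg one_pos le_rfl (z := alpha)
    (z' := fun x => 6 * x ^ 2 * (1 + x) ^ 2 / (1 + 2 * x) ^ 2)
    -- `k = 1 / gamma`, `L = k' / k`, and `B = z (1 - z) / z'` after cancelling the factors that
    -- vanish at `0`.
    (k := fun x => √(1 + 2 * x) / (1 + x + x ^ 2))
    (L := fun x => -3 * x * (1 + x) / ((1 + 2 * x) * (1 + x + x ^ 2)))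
    (B := fun x => x * (1 - x) * (1 + x) * (2 + x) / 6)
    ?_ ?_ ?_ ?_ ?_ ?_ ?_ ?_ ?_ ?_ p ⟨hp, hp1⟩, gamma, inv_div]
  · exact fun x hx => abs_lt.2 ⟨neg_one_lt_alpha hx.1, alpha_lt_one (hmem x hx).1 (hmem x hx).2⟩
  · exact fun x hx => hasDerivAt_alpha (by linarith [(hmem x hx).1])
  · intro x hx
    have h : 0 < 1 + 2 * x := by linarith [(hmem x hx).1]
    rw [one_sub_alpha h]
    unfold alpha
    field_simp
  · intro x hx
    have h : 0 < 1 + 2 * x := by linarith [(hmem x hx).1]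
    have h0 := one_add_self_add_sq_pos x
    positivity
  · intro x hx
    have h : 0 < 1 + 2 * x := by linarith [(hmem x hx).1]
    have h0 := one_add_self_add_sq_pos x
    refine (hasDerivAt_sqrt_div (((hasDerivAt_id' x).const_mul 2).const_add 1)
      (hasDerivAt_one_add_self_add_sq x) h h0.ne').congr_deriv ?_
    congr 1
    field_simp
    ring
  · intro x hx
    have h : 0 < 1 + 2 * x := by linarith [(hmem x hx).1]
    simp only [div_pow, Real.sq_sqrt h.le]
    ring
  · intro x hx
    have h : 0 < 1 + 2 * x := by linarith [(hmem x hx).1]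
    have h0 := (one_add_self_add_sq_pos x).ne'
    have hid := hasDerivAt_id' x
    refine (((((hid.fun_mul (hid.const_sub 1)).fun_mul (hid.const_add 1)).fun_mul
      (hid.const_add 2)).div_const 6).fun_mul (((hid.const_mul (-3)).fun_mul
      (hid.const_add 1)).fun_div (((hid.const_mul 2).const_add 1).fun_mul
      (hasDerivAt_one_add_self_add_sq x)) (mul_ne_zero h.ne' h0))).congr_deriv ?_
    have h' : 1 + x * 2 ≠ 0 := by linarith
    field_simp
    ring
  · simp [alpha]
  · simp
  · simp

theorem gauss2F1_beta_eq_gammaL_mul {p : ℝ} (hp : -(1 / 2) < p) (hpL : p < pStarL) :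
    gauss2F1 (1 / 3) (2 / 3) 1 (beta p) = gammaL p * gauss2F1 (1 / 2) (1 / 2) 1 (alphaL p) := by
  have hmem : ∀ x ∈ Set.Ioo (-(1 / 2)) pStarL, 0 < 1 - x ∧ 0 < 1 + x := fun x hx =>
    ⟨by linarith [hx.2, pStarL_lt_one], by linarith [hx.1]⟩
  have hsq : ∀ x : ℝ, 1 - x ^ 2 = (1 - x) * (1 + x) := fun x => by ring
  have hne : -(1 / 2 : ℝ) < 0 := by norm_num
  rw [gauss2F1_beta_eq le_rfl hne pStarL_pos pStarL_lt_one.le (z := alphaL)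
    (z' := fun x => -6 * x ^ 2 / ((1 - x) ^ 2 * (1 + x) ^ 4))
    -- `k = 1 / gammaL`, written as a square root over a rational function to fit
    -- `hasDerivAt_sqrt_div`.
    (k := fun x => √(1 - x ^ 2) / ((1 + x + x ^ 2) / (1 + x)))
    (L := fun x => -3 * x / ((1 - x) * (1 + x) * (1 + x + x ^ 2)))
    (B := fun x => x * (2 + x) * (1 + 2 * x) / (6 * (1 + x) ^ 2))
    ?_ ?_ ?_ ?_ ?_ ?_ ?_ ?_ ?_ ?_ p ⟨hp, hpL⟩, gammaL, inv_div, div_div]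
  · exact fun x hx => abs_lt.2
      ⟨neg_one_lt_alphaL hx.1 hx.2, alphaL_lt_one hx.1 (hx.2.trans pStarL_lt_one)⟩
  · exact fun x hx => hasDerivAt_alphaL (hmem x hx).1.ne' (hmem x hx).2.ne'
  · intro x hx
    obtain ⟨h1, h2⟩ := hmem x hx
    unfold alphaL
    rw [hsq]
    field_simp
    ring
  · intro x hx
    obtain ⟨h1, h2⟩ := hmem x hx
    have h0 := one_add_self_add_sq_pos x
    rw [hsq]
    positivity
  · intro x hx
    obtain ⟨h1, h2⟩ := hmem x hx
    have h0 := one_add_self_add_sq_pos x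
    have hid := hasDerivAt_id' x
    refine (hasDerivAt_sqrt_div ((hid.fun_pow 2).const_sub 1)
      ((hasDerivAt_one_add_self_add_sq x).fun_div (hid.const_add 1) h2.ne')
      (by rw [hsq]; positivity) (by positivity)).congr_deriv ?_
    congr 1
    rw [hsq]
    field_simp
    ring
  · intro x hx
    obtain ⟨h1, h2⟩ := hmem x hx
    have h0 := one_add_self_add_sq_pos x
    have h : 0 ≤ 1 - x ^ 2 := by rw [hsq]; positivity
    simp only [div_pow, Real.sq_sqrt h]
    rw [hsq]
    field_simp
  · intro x hx
    obtain ⟨h1, h2⟩ := hmem x hx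
    have h0 := (one_add_self_add_sq_pos x)
    have hid := hasDerivAt_id' x
    refine ((((hid.fun_mul (hid.const_add 2)).fun_mul ((hid.const_mul 2).const_add 1)).fun_div
      (((hid.const_add 1).fun_pow 2).const_mul 6) (by positivity)).fun_mul
      ((hid.const_mul (-3)).fun_div (((hid.const_sub 1).fun_mul (hid.const_add 1)).fun_mul
      (hasDerivAt_one_add_self_add_sq x)) (by positivity))).congr_deriv ?_
    field_simp
    ring
  · simp [alphaL]
  · simp
  · simp

/-! ### The endpoints, and convergence on the closed ranges. -/

/-- Passage to an endpoint at which the argument of `₂F₁(1/2, 1/2; 1; ·)` reaches `-1`. -/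
theorem gauss2F1_beta_eq_of_tendsto {s : Set ℝ} {p : ℝ} [(𝓝[s] p).NeBot] (hp : -(1 / 2) < p)
    (hp1 : p < 1) {z g : ℝ → ℝ} (hg : ContinuousAt g p) (hz : ContinuousAt z p) (hzp : z p = -1)
    (hz1 : ∀ᶠ x in 𝓝[s] p, -1 < z x)
    (heq : ∀ᶠ x in 𝓝[s] p, gauss2F1 (1 / 3) (2 / 3) 1 (beta x) =
      g x * gauss2F1 (1 / 2) (1 / 2) 1 (z x)) :
    gauss2F1 (1 / 3) (2 / 3) 1 (beta p) = g p * gauss2F1 (1 / 2) (1 / 2) 1 (z p) := by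
  obtain ⟨D, H, -, hG⟩ := exists_gauss2F1_flux (a := 1 / 3) (b := 2 / 3)
    (by norm_num) (by norm_num) (by norm_num)
  have h1 : Tendsto (fun x => gauss2F1 (1 / 3) (2 / 3) 1 (beta x)) (𝓝[s] p)
      (𝓝 (gauss2F1 (1 / 3) (2 / 3) 1 (beta p))) :=
    (((hG _ (abs_beta_lt_one hp hp1)).1.comp p (hasDerivAt_beta p)).continuousAt).mono_left
      nhdsWithin_le_nhds
  have h2 : Tendsto z (𝓝[s] p) (𝓝[>] (-1)) :=
    tendsto_nhdsWithin_iff.2 ⟨hzp ▸ hz.mono_left nhdsWithin_le_nhds, hz1⟩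
  have h3 := (hg.mono_left nhdsWithin_le_nhds).mul (tendsto_gauss2F1_half_neg_one.comp h2)
  rw [hzp]
  exact tendsto_nhds_unique h1 (h3.congr' (heq.mono fun x hx => hx.symm))

theorem gauss2F1_beta_pStar : gauss2F1 (1 / 3) (2 / 3) 1 (beta pStar) =
    gamma pStar * gauss2F1 (1 / 2) (1 / 2) 1 (alpha pStar) := by
  have h0 := neg_half_lt_pStar
  have h1 : pStar < 1 := pStar_neg.trans one_pos
  have h2 : 0 < 1 + 2 * pStar := by linarith
  refine gauss2F1_beta_eq_of_tendsto (s := Set.Ioi pStar) h0 h1 ?_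
    (hasDerivAt_alpha h2).continuousAt alpha_pStar ?_ ?_
  · unfold gamma
    exact ContinuousAt.div (by fun_prop) (by fun_prop) (Real.sqrt_pos.2 h2).ne'
  · filter_upwards [self_mem_nhdsWithin] with x hx using neg_one_lt_alpha hx
  · filter_upwards [Ioo_mem_nhdsGT h1] with x hx using gauss2F1_beta_eq_gamma_mul hx.1 hx.2

theorem gauss2F1_beta_pStarL : gauss2F1 (1 / 3) (2 / 3) 1 (beta pStarL) =
    gammaL pStarL * gauss2F1 (1 / 2) (1 / 2) 1 (alphaL pStarL) := by
  have h0 := pStarL_pos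
  have h1 := pStarL_lt_one
  have h2 : -(1 / 2) < pStarL := by linarith
  have h3 : 0 < 1 - pStarL ^ 2 := by nlinarith
  have h4 : Set.Ioo (-(1 / 2)) pStarL ∈ 𝓝[<] pStarL := Ioo_mem_nhdsLT h2
  refine gauss2F1_beta_eq_of_tendsto (s := Set.Iio pStarL) h2 h1 ?_
    (hasDerivAt_alphaL (by linarith) (by linarith)).continuousAt alphaL_pStarL ?_ ?_
  · unfold gammaL
    exact ContinuousAt.div (by fun_prop) (by fun_prop)
      (mul_ne_zero (by linarith) (Real.sqrt_pos.2 h3).ne')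
  · filter_upwards [h4] with x hx using neg_one_lt_alphaL hx.1 hx.2
  · filter_upwards [h4] with x hx using gauss2F1_beta_eq_gammaL_mul hx.1 hx.2

theorem gaussConverges_alpha {p : ℝ} (hp : pStar ≤ p) (hp1 : p < 1) :
    GaussConverges (1 / 2) (1 / 2) 1 (alpha p) := by
  refine gaussConverges_half ?_ (alpha_lt_one (neg_half_lt_pStar.trans_le hp) hp1)
  rcases hp.eq_or_lt with rfl | hp
  · exact alpha_pStar.ge
  · exact (neg_one_lt_alpha hp).le

theorem gaussConverges_alphaL {p : ℝ} (hp : -(1 / 2) < p) (hpL : p ≤ pStarL) :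
    GaussConverges (1 / 2) (1 / 2) 1 (alphaL p) := by
  refine gaussConverges_half ?_ (alphaL_lt_one hp (hpL.trans_lt pStarL_lt_one))
  rcases hpL.eq_or_lt with rfl | hpL
  · exact alphaL_pStarL.ge
  · exact (neg_one_lt_alphaL hp hpL).le

end RBBG

theorem mainTheorem1 :
    (-(1 / 2) < RBBG.pStar ∧ RBBG.pStar < 0 ∧ 0 < RBBG.pStarL ∧ RBBG.pStarL < 1) ∧
    (∀ p : ℝ, -(1 / 2) < p → p < 1 →
      RBBG.GaussConverges (1 / 3) (2 / 3) 1 (RBBG.beta p) ∧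
      (p ≤ RBBG.pStarL →
        RBBG.GaussConverges (1 / 2) (1 / 2) 1 (RBBG.alphaL p) ∧
        RBBG.gauss2F1 (1 / 3) (2 / 3) 1 (RBBG.beta p) =
          RBBG.gammaL p * RBBG.gauss2F1 (1 / 2) (1 / 2) 1 (RBBG.alphaL p)) ∧
      (RBBG.pStar ≤ p →
        RBBG.GaussConverges (1 / 2) (1 / 2) 1 (RBBG.alpha p) ∧
        RBBG.gauss2F1 (1 / 3) (2 / 3) 1 (RBBG.beta p) =
          RBBG.gamma p * RBBG.gauss2F1 (1 / 2) (1 / 2) 1 (RBBG.alpha p))) ∧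
    (∀ p : ℝ, RBBG.pStar ≤ p → p ≤ RBBG.pStarL →
      RBBG.GaussConverges (1 / 2) (1 / 2) 1 (RBBG.alpha p) ∧
      RBBG.GaussConverges (1 / 2) (1 / 2) 1 (RBBG.alphaL p)) := by
  refine ⟨⟨RBBG.neg_half_lt_pStar, RBBG.pStar_neg, RBBG.pStarL_pos, RBBG.pStarL_lt_one⟩,
    fun p hp hp1 => ⟨?_, fun hpL => ⟨RBBG.gaussConverges_alphaL hp hpL, ?_⟩,
      fun hpS => ⟨RBBG.gaussConverges_alpha hpS hp1, ?_⟩⟩,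
    fun p hpS hpL => ⟨RBBG.gaussConverges_alpha hpS (hpL.trans_lt RBBG.pStarL_lt_one),
      RBBG.gaussConverges_alphaL (RBBG.neg_half_lt_pStar.trans_le hpS) hpL⟩⟩
  · exact RBBG.gaussConverges_of_abs_lt (by norm_num) (by norm_num) (by norm_num)
      (RBBG.abs_beta_lt_one hp hp1)
  · rcases hpL.eq_or_lt with rfl | hpL
    · exact RBBG.gauss2F1_beta_pStarL
    · exact RBBG.gauss2F1_beta_eq_gammaL_mul hp hpL
  · rcases hpS.eq_or_lt with rfl | hpS
    · exact RBBG.gauss2F1_beta_pStar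
    · exact RBBG.gauss2F1_beta_eq_gamma_mul hpS hp1
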